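/- Let $n\ge 1$, $m\ge 0$ and $\epsilon>0$. Let $\mathcal S_n=\{X:\ X\ge 0,\ \mathrm{tr}(X)=1\}$ be the set of $n$-dimensional quantum states, as real symmetric or as complex Hermitian matrices, and let $C_1,\dots,C_m$ be closed convex sets of symmetric (respectively Hermitian) $n\times n$ matrices. Write $\|\cdot\|_{tr}$ for the trace norm and $\|\cdot\|$ for the operator norm. Consider the convex feasibility problem: find $X\in\mathcal S_n\cap C_1\cap\dots\cap C_m$ (a half-space $\{X:\mathrm{tr}(AX)\le\lambda\}$ may be one of the $C_i$). For each $i$ let $O_i$ be an $\epsilon$-separation oracle for $C_i$: on input of a state $X$, it accepts if $\|X-Y\|_{tr}\le\epsilon$ for some $Y\in C_i$, and otherwise it outputs a Hermitian matrix $P$ with $\|P\|\le 1$ and $\mathrm{tr}(P(X-Y))\ge\epsilon$ for all $Y\in C_i$. Hamiltonian Updates with parameters $T,\epsilon$ starts with $\rho=n^{-1}I$, $H=0$ and performs at most $T$ iterations. In each iteration it queries $O_1,\dots,O_m$ in this order on $\rho$. At the first oracle that outputs a matrix $P$, it replaces $H$ by $H+\tfrac{\epsilon}{8}P$ and then $\rho$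 by $\exp(-H)/\mathrm{tr}(\exp(-H))$, and goes on to the next iteration. If all oracles accept, it returns $(\rho,H)$ and stops. If $T$ iterations pass without a return, it flags the problem as infeasible. Theorem. Run with $T=\lceil 16\log(n)/\epsilon^2\rceil+1$ (natural logarithm), the algorithm executes at most $T$ iterations, and either it flags the problem as infeasible, and then $\mathcal S_n\cap C_1\cap\dots\cap C_m=\emptyset$, or it outputs a quantum state $\rho$ such that for every $i$ there is a $Y_i\in C_i$ with $\|Y_i-\rho\|_{tr}\le\epsilon$. -/

import Mathlib

/- `‖P‖` for a matrix is the operator norm on Euclidean space, and `0 ≤ z` for a scalar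
means that `z` is real and non-negative. -/
open scoped Matrix.Norms.L2Operator ComplexOrder

namespace HU

/-- The trace (Schatten-1) norm: the sum of the singular values. -/
noncomputable def traceNorm {𝕜 : Type*} [RCLike 𝕜] {n : ℕ}
    (A : Matrix (Fin n) (Fin n) 𝕜) : ℝ :=
  ∑ k ∈ Finset.range n, (Matrix.toEuclideanLin A).singularValues k

/-- An `n`-dimensional quantum state: a positive semidefinite matrix of unit trace. -/
def IsState {𝕜 : Type*} [RCLike 𝕜] {n : ℕ} (X : Matrix (Fin n) (Fin n) 𝕜) : Prop :=
  X.PosSemidef ∧ X.trace = 1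

/-- The feasible points of the problem: find a quantum state in `C 1 ∩ ⋯ ∩ C m`. -/
def feasibleSet {𝕜 : Type*} [RCLike 𝕜] {n m : ℕ}
    (C : Fin m → Set (Matrix (Fin n) (Fin n) 𝕜)) : Set (Matrix (Fin n) (Fin n) 𝕜) :=
  {X | IsState X ∧ ∀ i, X ∈ C i}

/-- `O` is an `ε`-separation oracle for `C`. On a quantum state `X` it accepts (answer `none`)
if some point of `C` is within trace-norm distance `ε`; otherwise it outputs (answer `some P`) a
Hermitian `P` of operator norm at most one with `tr (P (X - Y)) ≥ ε` for all `Y ∈ C`.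
Nothing is asked of its answers on matrices that are not states. -/
def IsSeparationOracle {𝕜 : Type*} [RCLike 𝕜] {n : ℕ}
    (C : Set (Matrix (Fin n) (Fin n) 𝕜)) (ε : ℝ)
    (O : Matrix (Fin n) (Fin n) 𝕜 → Option (Matrix (Fin n) (Fin n) 𝕜)) : Prop :=
  ∀ X : Matrix (Fin n) (Fin n) 𝕜, IsState X →
    ((∃ Y ∈ C, traceNorm (X - Y) ≤ ε) → O X = none) ∧
    ((¬ ∃ Y ∈ C, traceNorm (X - Y) ≤ ε) →
      ∃ P : Matrix (Fin n) (Fin n) 𝕜, O X = some P ∧ P.IsHermitian ∧ ‖P‖ ≤ 1 ∧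
        ∀ Y ∈ C, ε ≤ RCLike.re (P * (X - Y)).trace)

/-- The Gibbs state `exp (-H) / tr (exp (-H))`. -/
noncomputable def gibbsState {𝕜 : Type*} [RCLike 𝕜] {n : ℕ}
    (H : Matrix (Fin n) (Fin n) 𝕜) : Matrix (Fin n) (Fin n) 𝕜 :=
  ((NormedSpace.exp (-H)).trace)⁻¹ • NormedSpace.exp (-H)

/-- What the algorithm reports. -/
inductive Outcome (𝕜 : Type*) (n : ℕ) where
  /-- The algorithm returns the current pair `(ρ, H)`. -/
  | output (ρ H : Matrix (Fin n) (Fin n) 𝕜)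
  /-- All iterations were used without a return: the problem is flagged as infeasible. -/
  | infeasible

/-- The inner loop: query the oracles in the order `1, …, m` and stop at the first one that
does not accept, returning its hyperplane; `none` if all of them accept. -/
def queryOracles {𝕜 : Type*} {n m : ℕ}
    (O : Fin m → Matrix (Fin n) (Fin n) 𝕜 → Option (Matrix (Fin n) (Fin n) 𝕜))
    (ρ : Matrix (Fin n) (Fin n) 𝕜) : Option (Matrix (Fin n) (Fin n) 𝕜) :=
  (List.finRange m).findSome? fun i => O i ρ

/-- The outer loop, with the given number of iterations left, run from the current pair `(ρ, H)`.
The second component of the result counts the iterations that are executed. -/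
noncomputable def mainLoop {𝕜 : Type*} [RCLike 𝕜] {n m : ℕ} (ε : ℝ)
    (O : Fin m → Matrix (Fin n) (Fin n) 𝕜 → Option (Matrix (Fin n) (Fin n) 𝕜)) :
    ℕ → Matrix (Fin n) (Fin n) 𝕜 → Matrix (Fin n) (Fin n) 𝕜 → Outcome 𝕜 n × ℕ
  | 0, _, _ => (Outcome.infeasible, 0)
  | T + 1, ρ, H =>
    match queryOracles O ρ with
    | none => (Outcome.output ρ H, 1)
    | some P =>
      let r := mainLoop ε O T (gibbsState (H + (ε / 8) • P)) (H + (ε / 8) • P)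
      (r.1, r.2 + 1)

/-- Hamiltonian Updates with at most `T` iterations and accuracy `ε`, started at the maximally
mixed state `n⁻¹ I` and `H = 0`; it returns its outcome and the number of executed iterations. -/
noncomputable def hamiltonianUpdates {𝕜 : Type*} [RCLike 𝕜] {n m : ℕ} (T : ℕ) (ε : ℝ)
    (O : Fin m → Matrix (Fin n) (Fin n) 𝕜 → Option (Matrix (Fin n) (Fin n) 𝕜)) :
    Outcome 𝕜 n × ℕ :=
  mainLoop ε O T ((n : 𝕜)⁻¹ • (1 : Matrix (Fin n) (Fin n) 𝕜)) 0

/-- The number of iterations `⌈16 log n / ε²⌉ + 1`. -/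
noncomputable def iterationBound (n : ℕ) (ε : ℝ) : ℕ :=
  ⌈16 * Real.log n / ε ^ 2⌉₊ + 1

end HU

/-! For a feasible `X`, follow the free energy `log tr exp(-H) + tr(HX)`. It starts at `log n`, and
the Gibbs variational principle (`log_trace_exp_neg_add_nonneg`) keeps it non-negative. Whichever
oracle cuts, its hyperplane separates `ρ` from `X`, so an update lowers the free energy by at least
`ε² / 16` (`freeEnergy_update_le`). More than `16 log n / ε²` updates therefore rule out any
feasible `X`.

The decrease rests on smoothness of the log-partition function. Instead of Golden–Thompson, the
proof expands traces of `f(A) g(B)` over pairs of eigenvalues with non-negative weights, which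
reduces trace inequalities to scalar ones. -/

namespace HU

/-! ### Spectral calculus and trace inequalities -/

/-- The trace of a product of functions of two Hermitian matrices is a non-negative combination
of the products of their values on pairs of eigenvalues. -/
theorem exists_re_trace_cfc_mul_cfc {𝕜 : Type*} [RCLike 𝕜] {n : ℕ}
    {A B : Matrix (Fin n) (Fin n) 𝕜} (hA : A.IsHermitian) (hB : B.IsHermitian) :
    ∃ w : Fin n → Fin n → ℝ, (∀ i j, 0 ≤ w i j) ∧ ∀ f g : ℝ → ℝ,
      RCLike.re (cfc f A * cfc g B).trace =
        ∑ i, ∑ j, w i j * (f (hA.eigenvalues i) * g (hB.eigenvalues j)) := by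
  let U : Matrix (Fin n) (Fin n) 𝕜 := ↑hA.eigenvectorUnitary
  let V : Matrix (Fin n) (Fin n) 𝕜 := ↑hB.eigenvectorUnitary
  -- The weights are the squared overlaps of the two eigenbases.
  refine ⟨fun i j => ‖(star U * V) i j‖ ^ 2, fun i j => by positivity, fun f g => ?_⟩
  have hcyc : (cfc f A * cfc g B).trace =
      (Matrix.diagonal (RCLike.ofReal ∘ f ∘ hA.eigenvalues) * (star U * V) *
        (Matrix.diagonal (RCLike.ofReal ∘ g ∘ hB.eigenvalues) * star (star U * V))).trace := by
    rw [hA.cfc_eq, hB.cfc_eq, Matrix.IsHermitian.cfc, Matrix.IsHermitian.cfc,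
      Unitary.conjStarAlgAut_apply, Unitary.conjStarAlgAut_apply, star_mul, star_star]
    simp only [Matrix.mul_assoc]
    rw [Matrix.trace_mul_comm]
    simp only [Matrix.mul_assoc]
    rfl
  rw [hcyc, Matrix.trace, map_sum]
  refine Finset.sum_congr rfl fun i _ => ?_
  rw [Matrix.diag_apply, Matrix.mul_apply, map_sum]
  refine Finset.sum_congr rfl fun j _ => ?_
  rw [Matrix.diagonal_mul, Matrix.diagonal_mul, Matrix.star_apply]
  have h : ∀ (a b : ℝ) (z : 𝕜), RCLike.re ((a : 𝕜) * z * ((b : 𝕜) * star z)) =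
      ‖z‖ ^ 2 * (a * b) := by
    intro a b z
    rw [show (a : 𝕜) * z * ((b : 𝕜) * star z) = ((‖z‖ ^ 2 * (a * b) : ℝ) : 𝕜) by
      rw [mul_mul_mul_comm, RCLike.star_def, RCLike.mul_conj]; push_cast; ring]
    exact RCLike.ofReal_re _
  exact h _ _ _

theorem exp_eq_cfc {𝕜 : Type*} [RCLike 𝕜] {n : ℕ} {A : Matrix (Fin n) (Fin n) 𝕜}
    (hA : A.IsHermitian) : NormedSpace.exp A = cfc Real.exp A :=
  by
  rw [hA.cfc_eq, Matrix.IsHermitian.cfc]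
  conv_lhs => rw [hA.spectral_theorem]
  rw [Unitary.conjStarAlgAut_apply, Unitary.conjStarAlgAut_apply]
  have h := Matrix.exp_units_conj (Unitary.toUnits hA.eigenvectorUnitary)
    (Matrix.diagonal (RCLike.ofReal ∘ hA.eigenvalues : Fin n → 𝕜))
  refine h.trans ?_
  rw [Matrix.exp_diagonal]
  congr 3
  ext i
  rw [Pi.coe_exp, Function.comp_apply, Function.comp_apply, Function.comp_apply, Real.exp_eq_exp_ℝ]
  exact (NormedSpace.algebraMap_exp_comm (𝕂 := ℝ) (𝔸 := 𝕜) (hA.eigenvalues i)).symm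

theorem trace_exp_eq {𝕜 : Type*} [RCLike 𝕜] {n : ℕ} {A : Matrix (Fin n) (Fin n) 𝕜}
    (hA : A.IsHermitian) :
    (NormedSpace.exp A).trace = ((∑ i, Real.exp (hA.eigenvalues i) : ℝ) : 𝕜) := by
  rw [exp_eq_cfc hA, hA.cfc_eq, Matrix.IsHermitian.cfc, Unitary.conjStarAlgAut_apply,
    Matrix.trace_mul_comm, ← Matrix.mul_assoc]
  simp [Matrix.trace_diagonal]

theorem abs_eigenvalues_le_norm {𝕜 : Type*} [RCLike 𝕜] {n : ℕ} {A : Matrix (Fin n) (Fin n) 𝕜}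
    (hA : A.IsHermitian) (i : Fin n) : |hA.eigenvalues i| ≤ ‖A‖ := by
  have h := Matrix.l2_opNorm_mulVec A (hA.eigenvectorBasis i)
  rw [hA.mulVec_eigenvectorBasis] at h
  have h1 : ‖hA.eigenvectorBasis i‖ = 1 := hA.eigenvectorBasis.orthonormal.1 i
  have h2 : (EuclideanSpace.equiv (Fin n) 𝕜).symm
      (hA.eigenvalues i • (⇑(hA.eigenvectorBasis i) : Fin n → 𝕜)) =
      hA.eigenvalues i • hA.eigenvectorBasis i := by ext; simp
  rw [h2, norm_smul, h1] at h
  simpa using h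

theorem traceNorm_sub_comm {𝕜 : Type*} [RCLike 𝕜] {n : ℕ} (X Y : Matrix (Fin n) (Fin n) 𝕜) :
    traceNorm (X - Y) = traceNorm (Y - X) := by
  have h : ∀ T : EuclideanSpace 𝕜 (Fin n) →ₗ[𝕜] EuclideanSpace 𝕜 (Fin n),
      (-T).singularValues = T.singularValues := by
    intro T
    have hT : LinearMap.adjoint (-T) ∘ₗ (-T) = LinearMap.adjoint T ∘ₗ T := by
      rw [map_neg]; ext; simp
    simp only [LinearMap.singularValues, hT]
  rw [traceNorm, traceNorm, ← neg_sub Y X, map_neg, h]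

/-- `|tr (P X)| ≤ 1` for a state `X` and an observable `P` with `‖P‖ ≤ 1`. -/
theorem abs_re_trace_mul_le {𝕜 : Type*} [RCLike 𝕜] {n : ℕ} {P X : Matrix (Fin n) (Fin n) 𝕜}
    (hP : P.IsHermitian) (hP1 : ‖P‖ ≤ 1) (hX : IsState X) :
    |RCLike.re (P * X).trace| ≤ 1 := by
  obtain ⟨w, hw, h⟩ := exists_re_trace_cfc_mul_cfc hP hX.1.1
  have h1 := h id id
  -- The constant function turns `tr X = 1` into a normalisation of the weighted sum.
  have h2 := h (fun _ => 1) id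
  rw [cfc_id ℝ P hP.isSelfAdjoint, cfc_id ℝ X hX.1.1.isSelfAdjoint] at h1
  rw [cfc_const_one ℝ P hP.isSelfAdjoint, cfc_id ℝ X hX.1.1.isSelfAdjoint, one_mul] at h2
  replace h2 := (congrArg RCLike.re hX.2).symm.trans h2
  rw [RCLike.one_re] at h2
  rw [h1, h2]
  refine (Finset.abs_sum_le_sum_abs _ _).trans (Finset.sum_le_sum fun i _ =>
    (Finset.abs_sum_le_sum_abs _ _).trans (Finset.sum_le_sum fun j _ => ?_))
  have hx := hX.1.eigenvalues_nonneg j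
  simp only [id]
  rw [abs_mul, abs_mul, abs_of_nonneg (hw i j), abs_of_nonneg hx]
  exact mul_le_mul_of_nonneg_left (mul_le_mul_of_nonneg_right
    ((abs_eigenvalues_le_norm hP i).trans hP1) hx) (hw i j)

/-- The free energy of a state is at least minus the log-partition function. -/
theorem log_trace_exp_neg_add_nonneg {𝕜 : Type*} [RCLike 𝕜] {n : ℕ}
    {H X : Matrix (Fin n) (Fin n) 𝕜} (hH : H.IsHermitian) (hX : IsState X) :
    0 ≤ Real.log (RCLike.re (NormedSpace.exp (-H)).trace) + RCLike.re (H * X).trace := by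
  obtain ⟨w, hw, h⟩ := exists_re_trace_cfc_mul_cfc hH.neg hX.1.1
  have h1 := h id id
  have h2 := h (fun _ => 1) id
  rw [cfc_id ℝ (-H) hH.neg.isSelfAdjoint, cfc_id ℝ X hX.1.1.isSelfAdjoint, neg_mul, Matrix.trace_neg, map_neg] at h1
  rw [cfc_const_one ℝ (-H) hH.neg.isSelfAdjoint, cfc_id ℝ X hX.1.1.isSelfAdjoint, one_mul] at h2
  replace h2 := (congrArg RCLike.re hX.2).symm.trans h2
  rw [RCLike.one_re] at h2
  rw [trace_exp_eq hH.neg, RCLike.ofReal_re, ← sub_neg_eq_add, h1, sub_nonneg]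
  set Z := ∑ i, Real.exp (hH.neg.eigenvalues i)
  have hle : ∀ i, hH.neg.eigenvalues i ≤ Real.log Z := fun i => by
    have h3 : Real.exp (hH.neg.eigenvalues i) ≤ Z :=
      Finset.single_le_sum (f := fun i => Real.exp (hH.neg.eigenvalues i))
        (fun _ _ => (Real.exp_pos _).le) (Finset.mem_univ i)
    exact (Real.le_log_iff_exp_le ((Real.exp_pos _).trans_le h3)).2 h3
  calc _ ≤ ∑ i, ∑ j, Real.log Z * (w i j * (1 * id (hX.1.1.eigenvalues j))) := by
        refine Finset.sum_le_sum fun i _ => Finset.sum_le_sum fun j _ => ?_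
        have := mul_le_mul_of_nonneg_left (mul_le_mul_of_nonneg_right (hle i)
          (hX.1.eigenvalues_nonneg j)) (hw i j)
        simp only [id]
        linarith
    _ = Real.log Z := by simp only [← Finset.mul_sum]; rw [← h2, mul_one]

theorem re_trace_mul_self_mul_exp_le {𝕜 : Type*} [RCLike 𝕜] {n : ℕ}
    {P A : Matrix (Fin n) (Fin n) 𝕜} (hP : P.IsHermitian) (hP1 : ‖P‖ ≤ 1) (hA : A.IsHermitian) :
    RCLike.re (P * P * NormedSpace.exp A).trace ≤ RCLike.re (NormedSpace.exp A).trace := by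
  obtain ⟨w, hw, h⟩ := exists_re_trace_cfc_mul_cfc hP hA
  have h1 := h (fun x => x * x) Real.exp
  have h2 := h (fun _ => 1) Real.exp
  rw [cfc_mul (fun x => x) (fun x => x) P, cfc_id' ℝ P hP.isSelfAdjoint, ← exp_eq_cfc hA] at h1
  rw [cfc_const_one ℝ P hP.isSelfAdjoint, one_mul, ← exp_eq_cfc hA] at h2
  rw [h1, h2]
  refine Finset.sum_le_sum fun i _ => Finset.sum_le_sum fun j _ => ?_
  refine mul_le_mul_of_nonneg_left (mul_le_mul_of_nonneg_right ?_ (Real.exp_pos _).le) (hw i j)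
  have := abs_le.1 ((abs_eigenvalues_le_norm hP i).trans hP1)
  nlinarith

/-- Tangent lines at `a` and `b` bound the left side by `(a - b) * (exp a - exp b)`, then by the
square. The remainder uses only the endpoints, so that its matrix version splits into traces of
`f(A) g(B)`. -/
theorem exp_sub_exp_sub_mul_exp_le (a b : ℝ) :
    Real.exp a - Real.exp b - (a - b) * Real.exp b ≤
      (a - b) * (a - b) * (Real.exp a + Real.exp b) := by
  have h1 : Real.exp a - Real.exp b ≤ (a - b) * Real.exp a := by
    have := mul_le_mul_of_nonneg_left (Real.add_one_le_exp (b - a)) (Real.exp_pos a).le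
    rw [← Real.exp_add, add_sub_cancel] at this
    linarith
  have h2 : (a - b) * Real.exp b ≤ Real.exp a - Real.exp b := by
    have := mul_le_mul_of_nonneg_left (Real.add_one_le_exp (a - b)) (Real.exp_pos b).le
    rw [← Real.exp_add, add_sub_cancel] at this
    linarith
  have ha := Real.exp_pos a
  have hb := Real.exp_pos b
  rcases le_total b a with hab | hab
  · nlinarith [mul_le_mul_of_nonneg_left h1 (sub_nonneg.2 hab),
      mul_nonneg (mul_self_nonneg (a - b)) hb.le]
  · nlinarith [mul_le_mul_of_nonneg_left h2 (sub_nonneg.2 hab),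
      mul_nonneg (mul_self_nonneg (a - b)) ha.le]

/-- Second-order upper bound for the trace exponential. -/
theorem re_trace_exp_le {𝕜 : Type*} [RCLike 𝕜] {n : ℕ}
    {A B : Matrix (Fin n) (Fin n) 𝕜} (hA : A.IsHermitian) (hB : B.IsHermitian) :
    RCLike.re (NormedSpace.exp A).trace - RCLike.re (NormedSpace.exp B).trace
        - RCLike.re ((A - B) * NormedSpace.exp B).trace ≤
      RCLike.re ((A - B) * (A - B) * NormedSpace.exp A).trace +
        RCLike.re ((A - B) * (A - B) * NormedSpace.exp B).trace := by
  obtain ⟨w, hw, h⟩ := exists_re_trace_cfc_mul_cfc hA hB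
  have e1 : RCLike.re (NormedSpace.exp A).trace =
      ∑ i, ∑ j, w i j * (Real.exp (hA.eigenvalues i) * 1) := by
    rw [← h Real.exp (fun _ => 1), cfc_const_one ℝ B hB.isSelfAdjoint, mul_one, exp_eq_cfc hA]
  have e2 : RCLike.re (NormedSpace.exp B).trace =
      ∑ i, ∑ j, w i j * (1 * Real.exp (hB.eigenvalues j)) := by
    rw [← h (fun _ => 1) Real.exp, cfc_const_one ℝ A hA.isSelfAdjoint, one_mul, exp_eq_cfc hB]
  have hcA : NormedSpace.exp A * A = A * NormedSpace.exp A :=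
    ((Commute.refl A).exp_left).eq
  have hcB : NormedSpace.exp B * B = B * NormedSpace.exp B :=
    ((Commute.refl B).exp_left).eq
  have fA2 : cfc (fun x : ℝ => x * x) A = A * A := by
    rw [cfc_mul (fun x => x) (fun x => x) A, cfc_id' ℝ A hA.isSelfAdjoint]
  have fB2 : cfc (fun x : ℝ => x * x) B = B * B := by
    rw [cfc_mul (fun x => x) (fun x => x) B, cfc_id' ℝ B hB.isSelfAdjoint]
  have fAe : cfc (fun x : ℝ => x * Real.exp x) A = A * NormedSpace.exp A := by
    rw [cfc_mul (fun x => x) Real.exp A, cfc_id' ℝ A hA.isSelfAdjoint, exp_eq_cfc hA]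
  have fBe : cfc (fun x : ℝ => x * Real.exp x) B = B * NormedSpace.exp B := by
    rw [cfc_mul (fun x => x) Real.exp B, cfc_id' ℝ B hB.isSelfAdjoint, exp_eq_cfc hB]
  have fA2e : cfc (fun x : ℝ => x * x * Real.exp x) A = A * A * NormedSpace.exp A := by
    rw [cfc_mul (fun x => x * x) Real.exp A, fA2, exp_eq_cfc hA]
  have fB2e : cfc (fun x : ℝ => x * x * Real.exp x) B = B * B * NormedSpace.exp B := by
    rw [cfc_mul (fun x => x * x) Real.exp B, fB2, exp_eq_cfc hB]
  have t1 := h (fun x => x) Real.exp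
  have t2 := h (fun _ => 1) (fun x => x * Real.exp x)
  have t3 := h (fun x => x * x * Real.exp x) (fun _ => 1)
  have t4 := h (fun x => x * Real.exp x) (fun x => x)
  have t5 := h Real.exp (fun x => x * x)
  have t6 := h (fun x => x * x) Real.exp
  have t7 := h (fun x => x) (fun x => x * Real.exp x)
  have t8 := h (fun _ => 1) (fun x => x * x * Real.exp x)
  rw [cfc_id' ℝ A hA.isSelfAdjoint, ← exp_eq_cfc hB] at t1
  rw [cfc_const_one ℝ A hA.isSelfAdjoint, fBe, one_mul] at t2
  rw [cfc_const_one ℝ B hB.isSelfAdjoint, fA2e, mul_one] at t3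
  rw [cfc_id' ℝ B hB.isSelfAdjoint, fAe] at t4
  rw [fB2, ← exp_eq_cfc hA] at t5
  rw [fA2, ← exp_eq_cfc hB] at t6
  rw [cfc_id' ℝ A hA.isSelfAdjoint, fBe] at t7
  rw [cfc_const_one ℝ A hA.isSelfAdjoint, fB2e, one_mul] at t8
  -- Cyclicity, and `A` commuting with `exp A`, bring each cross term to the form `f(A) g(B)`.
  have c1 : (A * B * NormedSpace.exp A).trace = (A * NormedSpace.exp A * B).trace := by
    rw [Matrix.mul_assoc, Matrix.trace_mul_comm, Matrix.mul_assoc, hcA, Matrix.trace_mul_comm]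
  have c2 : (B * A * NormedSpace.exp A).trace = (A * NormedSpace.exp A * B).trace := by
    rw [Matrix.mul_assoc, Matrix.trace_mul_comm]
  have c3 : (B * B * NormedSpace.exp A).trace = (NormedSpace.exp A * (B * B)).trace :=
    Matrix.trace_mul_comm _ _
  have c4 : (B * A * NormedSpace.exp B).trace = (A * (B * NormedSpace.exp B)).trace := by
    rw [Matrix.mul_assoc, Matrix.trace_mul_comm, Matrix.mul_assoc, hcB]
  have c5 : (A * B * NormedSpace.exp B).trace = (A * (B * NormedSpace.exp B)).trace := by
    rw [Matrix.mul_assoc]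
  simp only [Matrix.sub_mul, Matrix.mul_sub, Matrix.trace_sub, map_sub]
  rw [c1, c2, c3, c4, c5, e1, e2, t1, t2, t3, t4, t5, t6, t7, t8]
  simp only [← Finset.sum_sub_distrib, ← Finset.sum_add_distrib]
  refine Finset.sum_le_sum fun i _ => Finset.sum_le_sum fun j _ => ?_
  have := mul_le_mul_of_nonneg_left (exp_sub_exp_sub_mul_exp_le (hA.eigenvalues i)
    (hB.eigenvalues j)) (hw i j)
  linarith

/-! ### Gibbs states and the free energy -/

theorem isState_gibbsState {𝕜 : Type*} [RCLike 𝕜] {n : ℕ} (hn : 0 < n)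
    {H : Matrix (Fin n) (Fin n) 𝕜} (hH : H.IsHermitian) : IsState (gibbsState H) := by
  have : Nonempty (Fin n) := ⟨⟨0, hn⟩⟩
  have hpos : 0 < ∑ i, Real.exp (hH.neg.eigenvalues i) :=
    Finset.sum_pos (fun _ _ => Real.exp_pos _) Finset.univ_nonempty
  constructor
  · have h1 : (NormedSpace.exp (-H)).PosSemidef := by
      rw [exp_eq_cfc hH.neg]
      open scoped MatrixOrder in exact Matrix.nonneg_iff_posSemidef.1 (cfc_nonneg fun x _ => (Real.exp_pos x).le)
    rw [gibbsState, trace_exp_eq hH.neg]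
    exact h1.smul (by rw [← RCLike.ofReal_inv]; exact_mod_cast inv_nonneg.2 hpos.le)
  · rw [gibbsState, Matrix.trace_smul, trace_exp_eq hH.neg, smul_eq_mul]
    exact inv_mul_cancel₀ (by exact_mod_cast hpos.ne')

theorem gibbsState_zero {𝕜 : Type*} [RCLike 𝕜] {n : ℕ} :
    gibbsState (0 : Matrix (Fin n) (Fin n) 𝕜) = (n : 𝕜)⁻¹ • 1 := by
  simp [gibbsState, NormedSpace.exp_zero]


theorem re_trace_exp_pos {𝕜 : Type*} [RCLike 𝕜] {n : ℕ} (hn : 0 < n)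
    {A : Matrix (Fin n) (Fin n) 𝕜} (hA : A.IsHermitian) :
    0 < RCLike.re (NormedSpace.exp A).trace := by
  have : Nonempty (Fin n) := ⟨⟨0, hn⟩⟩
  rw [trace_exp_eq hA, RCLike.ofReal_re]
  exact Finset.sum_pos (fun _ _ => Real.exp_pos _) Finset.univ_nonempty

theorem re_trace_mul_gibbsState {𝕜 : Type*} [RCLike 𝕜] {n : ℕ}
    {H : Matrix (Fin n) (Fin n) 𝕜} (hH : H.IsHermitian) (P : Matrix (Fin n) (Fin n) 𝕜) :
    RCLike.re (P * gibbsState H).trace =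
      RCLike.re (P * NormedSpace.exp (-H)).trace / RCLike.re (NormedSpace.exp (-H)).trace := by
  rw [gibbsState, Matrix.mul_smul, Matrix.trace_smul, trace_exp_eq hH.neg, RCLike.ofReal_re,
    ← RCLike.ofReal_inv, smul_eq_mul, RCLike.re_ofReal_mul, div_eq_inv_mul]

theorem isHermitian_add_smul {𝕜 : Type*} [RCLike 𝕜] {n : ℕ}
    {H P : Matrix (Fin n) (Fin n) 𝕜} (hH : H.IsHermitian) (hP : P.IsHermitian) (c : ℝ) :
    (H + c • P).IsHermitian :=
  hH.add (by rw [Matrix.IsHermitian, Matrix.conjTranspose_smul, hP.eq, star_trivial])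

/-- Smoothness of the log-partition function. -/
theorem log_trace_exp_neg_add_smul_le {𝕜 : Type*} [RCLike 𝕜] {n : ℕ} (hn : 0 < n)
    {H P : Matrix (Fin n) (Fin n) 𝕜} (hH : H.IsHermitian) (hP : P.IsHermitian) (hP1 : ‖P‖ ≤ 1)
    {c : ℝ} (hc0 : 0 ≤ c) (hc : c ≤ 1 / 4) :
    Real.log (RCLike.re (NormedSpace.exp (-(H + c • P))).trace) ≤
      Real.log (RCLike.re (NormedSpace.exp (-H)).trace)
        - c * RCLike.re (P * gibbsState H).trace + 3 * c ^ 2 := by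
  have hH' := isHermitian_add_smul hH hP c
  have h := re_trace_exp_le hH'.neg hH.neg
  have hsub : -(H + c • P) - -H = -(c • P) := by abel
  have hsq : -(c • P) * -(c • P) = (c ^ 2) • (P * P) := by
    rw [neg_mul_neg, smul_mul_smul_comm, pow_two]
  have hlin : -(c • P) * NormedSpace.exp (-H) = -(c • (P * NormedSpace.exp (-H))) := by
    rw [neg_mul, smul_mul_assoc]
  rw [hsub, hsq, hlin, smul_mul_assoc, smul_mul_assoc] at h
  simp only [Matrix.trace_smul, Matrix.trace_neg, map_neg, RCLike.smul_re] at h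
  have b1 := re_trace_mul_self_mul_exp_le hP hP1 hH'.neg
  have b2 := re_trace_mul_self_mul_exp_le hP hP1 hH.neg
  have hZ := re_trace_exp_pos hn hH.neg
  have hZ' := re_trace_exp_pos hn hH'.neg
  rw [re_trace_mul_gibbsState hH]
  generalize RCLike.re (NormedSpace.exp (-(H + c • P))).trace = Z' at *
  generalize RCLike.re (NormedSpace.exp (-H)).trace = Z at *
  generalize RCLike.re (P * NormedSpace.exp (-H)).trace = q at *
  have hc2 : c ^ 2 ≤ 1 / 16 := by nlinarith
  have b1' := mul_le_mul_of_nonneg_left b1 (sq_nonneg c)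
  have b2' := mul_le_mul_of_nonneg_left b2 (sq_nonneg c)
  -- The remainder `c² (Z + Z')` involves the new partition function, so its share moves to the
  -- left. After logarithms, the right factor costs `c²` and the left one at most `2c²`.
  have key : Z' * (1 - c ^ 2) ≤ Z * (1 - c * (q / Z) + c ^ 2) := by
    have : Z * (q / Z) = q := by field_simp
    have e : Z * (1 - c * (q / Z) + c ^ 2) = Z - c * q + Z * c ^ 2 := by
      linear_combination (-c) * this
    rw [e]; linarith
  have hpos1 : 0 < 1 - c ^ 2 := by linarith
  have hpos2 : 0 < 1 - c * (q / Z) + c ^ 2 :=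
    pos_of_mul_pos_right ((mul_pos hZ' hpos1).trans_le key) hZ.le
  have hlog := Real.log_le_log (mul_pos hZ' hpos1) key
  rw [Real.log_mul hZ'.ne' hpos1.ne', Real.log_mul hZ.ne' hpos2.ne'] at hlog
  have l1 := Real.log_le_sub_one_of_pos hpos2
  have l2 := Real.one_sub_inv_le_log_of_pos hpos1
  have l3 : (1 - c ^ 2)⁻¹ ≤ 1 + 2 * c ^ 2 := by
    rw [inv_le_iff_one_le_mul₀ hpos1]
    nlinarith [sq_nonneg c]
  linarith

/-- Every update decreases the free energy of a separated state by `ε² / 16`. -/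
theorem freeEnergy_update_le {𝕜 : Type*} [RCLike 𝕜] {n : ℕ} (hn : 0 < n) {ε : ℝ} (hε : 0 < ε)
    {H P X : Matrix (Fin n) (Fin n) 𝕜} (hH : H.IsHermitian) (hP : P.IsHermitian) (hP1 : ‖P‖ ≤ 1)
    (hX : IsState X) (hsep : ε ≤ RCLike.re (P * (gibbsState H - X)).trace) :
    Real.log (RCLike.re (NormedSpace.exp (-(H + (ε / 8) • P))).trace)
        + RCLike.re ((H + (ε / 8) • P) * X).trace + ε ^ 2 / 16 ≤
      Real.log (RCLike.re (NormedSpace.exp (-H)).trace) + RCLike.re (H * X).trace := by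
  have h1 := abs_le.1 (abs_re_trace_mul_le hP hP1 hX)
  have h2 := abs_le.1 (abs_re_trace_mul_le hP hP1 (isState_gibbsState hn hH))
  rw [Matrix.mul_sub, Matrix.trace_sub, map_sub] at hsep
  -- Separating two states forces `ε ≤ 2`, hence `c ≤ 1/4`. The net gain is `ε²/8 - 3ε²/64 = 5ε²/64
  -- ≥ ε²/16`.
  have h3 := log_trace_exp_neg_add_smul_le hn hH hP hP1 (c := ε / 8) (by positivity)
    (by linarith)
  rw [Matrix.add_mul, smul_mul_assoc, Matrix.trace_add, Matrix.trace_smul, map_add,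
    RCLike.smul_re]
  nlinarith

/-! ### Oracles and the loop -/

theorem exists_oracle_of_queryOracles_eq_some {𝕜 : Type*} {n m : ℕ}
    {O : Fin m → Matrix (Fin n) (Fin n) 𝕜 → Option (Matrix (Fin n) (Fin n) 𝕜)}
    {ρ P : Matrix (Fin n) (Fin n) 𝕜} (h : queryOracles O ρ = some P) :
    ∃ i, O i ρ = some P := by
  obtain ⟨i, _, hi⟩ := List.exists_of_findSome?_eq_some h
  exact ⟨i, hi⟩

theorem oracle_eq_none_of_queryOracles_eq_none {𝕜 : Type*} {n m : ℕ}
    {O : Fin m → Matrix (Fin n) (Fin n) 𝕜 → Option (Matrix (Fin n) (Fin n) 𝕜)}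
    {ρ : Matrix (Fin n) (Fin n) 𝕜} (h : queryOracles O ρ = none) (i : Fin m) :
    O i ρ = none :=
  List.findSome?_eq_none_iff.1 h i (List.mem_finRange i)

theorem IsSeparationOracle.exists_near {𝕜 : Type*} [RCLike 𝕜] {n : ℕ}
    {C : Set (Matrix (Fin n) (Fin n) 𝕜)} {ε : ℝ}
    {O : Matrix (Fin n) (Fin n) 𝕜 → Option (Matrix (Fin n) (Fin n) 𝕜)}
    (hO : IsSeparationOracle C ε O) {X : Matrix (Fin n) (Fin n) 𝕜} (hX : IsState X)
    (h : O X = none) : ∃ Y ∈ C, traceNorm (X - Y) ≤ ε := by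
  by_contra hc
  obtain ⟨P, hP, -⟩ := (hO X hX).2 hc
  simp [h] at hP

theorem IsSeparationOracle.separates {𝕜 : Type*} [RCLike 𝕜] {n : ℕ}
    {C : Set (Matrix (Fin n) (Fin n) 𝕜)} {ε : ℝ}
    {O : Matrix (Fin n) (Fin n) 𝕜 → Option (Matrix (Fin n) (Fin n) 𝕜)}
    (hO : IsSeparationOracle C ε O) {X P : Matrix (Fin n) (Fin n) 𝕜} (hX : IsState X)
    (h : O X = some P) :
    P.IsHermitian ∧ ‖P‖ ≤ 1 ∧ ∀ Y ∈ C, ε ≤ RCLike.re (P * (X - Y)).trace := by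
  by_cases hc : ∃ Y ∈ C, traceNorm (X - Y) ≤ ε
  · simp [(hO X hX).1 hc] at h
  · obtain ⟨P', hP', hP''⟩ := (hO X hX).2 hc
    obtain rfl : P' = P := Option.some.inj (hP'.symm.trans h)
    exact hP''

theorem mainLoop_snd_le {𝕜 : Type*} [RCLike 𝕜] {n m : ℕ} (ε : ℝ)
    (O : Fin m → Matrix (Fin n) (Fin n) 𝕜 → Option (Matrix (Fin n) (Fin n) 𝕜)) (T : ℕ)
    (ρ H : Matrix (Fin n) (Fin n) 𝕜) : (mainLoop ε O T ρ H).2 ≤ T := by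
  induction T generalizing ρ H with
  | zero => simp [mainLoop]
  | succ T ih =>
    rw [mainLoop]
    cases queryOracles O ρ with
    | none => simp
    | some P => exact Nat.succ_le_succ (ih _ _)

/-- Starting from `gibbsState H` with `H` Hermitian is the loop invariant: every queried matrix is
then a state, where the oracles are reliable. -/
theorem mainLoop_fst {𝕜 : Type*} [RCLike 𝕜] {n m : ℕ} (hn : 0 < n) {ε : ℝ}
    {C : Fin m → Set (Matrix (Fin n) (Fin n) 𝕜)}
    {O : Fin m → Matrix (Fin n) (Fin n) 𝕜 → Option (Matrix (Fin n) (Fin n) 𝕜)}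
    (hO : ∀ i, IsSeparationOracle (C i) ε (O i)) (T : ℕ)
    {H : Matrix (Fin n) (Fin n) 𝕜} (hH : H.IsHermitian) :
    (mainLoop ε O T (gibbsState H) H).1 = Outcome.infeasible ∨
      ∃ ρ H' : Matrix (Fin n) (Fin n) 𝕜,
        (mainLoop ε O T (gibbsState H) H).1 = Outcome.output ρ H' ∧
        IsState ρ ∧ ∀ i, ∃ Y ∈ C i, traceNorm (Y - ρ) ≤ ε := by
  induction T generalizing H with
  | zero => exact Or.inl rfl
  | succ T ih =>
    have hρ := isState_gibbsState hn hH
    rw [mainLoop]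
    cases h : queryOracles O (gibbsState H) with
    | none =>
      refine Or.inr ⟨_, _, rfl, hρ, fun i => ?_⟩
      obtain ⟨Y, hY, hd⟩ :=
        (hO i).exists_near hρ (oracle_eq_none_of_queryOracles_eq_none h i)
      exact ⟨Y, hY, (traceNorm_sub_comm Y _).trans_le hd⟩
    | some P =>
      obtain ⟨i, hi⟩ := exists_oracle_of_queryOracles_eq_some h
      exact ih (isHermitian_add_smul hH ((hO i).separates hρ hi).1 _)

/-- If the loop ends without a return, the free energy of each feasible point was large. -/
theorem le_freeEnergy_of_mainLoop_infeasible {𝕜 : Type*} [RCLike 𝕜] {n m : ℕ} (hn : 0 < n)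
    {ε : ℝ} (hε : 0 < ε) {C : Fin m → Set (Matrix (Fin n) (Fin n) 𝕜)}
    {O : Fin m → Matrix (Fin n) (Fin n) 𝕜 → Option (Matrix (Fin n) (Fin n) 𝕜)}
    (hO : ∀ i, IsSeparationOracle (C i) ε (O i))
    {X : Matrix (Fin n) (Fin n) 𝕜} (hX : X ∈ feasibleSet C) (T : ℕ)
    {H : Matrix (Fin n) (Fin n) 𝕜} (hH : H.IsHermitian)
    (hinf : (mainLoop ε O T (gibbsState H) H).1 = Outcome.infeasible) :
    T * (ε ^ 2 / 16) ≤
      Real.log (RCLike.re (NormedSpace.exp (-H)).trace) + RCLike.re (H * X).trace := by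
  induction T generalizing H with
  | zero => simpa using log_trace_exp_neg_add_nonneg hH hX.1
  | succ T ih =>
    have hρ := isState_gibbsState hn hH
    rw [mainLoop] at hinf
    cases h : queryOracles O (gibbsState H) with
    | none => simp [h] at hinf
    | some P =>
      rw [h] at hinf
      obtain ⟨i, hi⟩ := exists_oracle_of_queryOracles_eq_some h
      obtain ⟨hP, hP1, hsep⟩ := (hO i).separates hρ hi
      have h1 := ih (isHermitian_add_smul hH hP (ε / 8)) hinf
      have h2 := freeEnergy_update_le hn hε hH hP hP1 hX.1 (hsep X (hX.2 i))
      push_cast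
      linarith

end HU

theorem mainTheorem2 {𝕜 : Type*} [RCLike 𝕜] (n m : ℕ) (hn : 0 < n) (ε : ℝ) (hε : 0 < ε)
    (C : Fin m → Set (Matrix (Fin n) (Fin n) 𝕜))
    (hherm : ∀ i, ∀ X ∈ C i, X.IsHermitian)
    (hclosed : ∀ i, IsClosed (C i))
    (hconvex : ∀ i, Convex ℝ (C i))
    (O : Fin m → Matrix (Fin n) (Fin n) 𝕜 → Option (Matrix (Fin n) (Fin n) 𝕜))
    (hO : ∀ i, HU.IsSeparationOracle (C i) ε (O i)) :
    (HU.hamiltonianUpdates (HU.iterationBound n ε) ε O).2 ≤ HU.iterationBound n ε ∧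
    (((HU.hamiltonianUpdates (HU.iterationBound n ε) ε O).1 = HU.Outcome.infeasible ∧
        HU.feasibleSet C = ∅) ∨
      ∃ ρ H : Matrix (Fin n) (Fin n) 𝕜,
        (HU.hamiltonianUpdates (HU.iterationBound n ε) ε O).1 = HU.Outcome.output ρ H ∧
        HU.IsState ρ ∧ ∀ i, ∃ Y ∈ C i, HU.traceNorm (Y - ρ) ≤ ε) := by

  -- The maximally mixed state is the Gibbs state of `H = 0`, so the invariant holds at the start.
  rw [HU.hamiltonianUpdates, ← HU.gibbsState_zero]
  have h0 : (0 : Matrix (Fin n) (Fin n) 𝕜).IsHermitian := Matrix.isHermitian_zero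
  refine ⟨HU.mainLoop_snd_le _ _ _ _ _, ?_⟩
  rcases HU.mainLoop_fst hn hO (HU.iterationBound n ε) h0 with hinf | hout
  · refine Or.inl ⟨hinf, Set.eq_empty_iff_forall_notMem.2 fun X hX => ?_⟩
    have h := HU.le_freeEnergy_of_mainLoop_infeasible hn hε hO hX _ h0 hinf
    rw [neg_zero, NormedSpace.exp_zero, Matrix.trace_one, Fintype.card_fin, RCLike.natCast_re,
      zero_mul, Matrix.trace_zero, map_zero, add_zero, HU.iterationBound] at h
    -- The `+ 1` in `iterationBound` makes `T * (ε² / 16)` strictly exceed the initial free energy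
    -- `log n`.
    have hT := Nat.le_ceil (16 * Real.log n / ε ^ 2)
    rw [div_le_iff₀ (by positivity)] at hT
    push_cast at h
    nlinarith [pow_pos hε 2]
  · exact Or.inr hout
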